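/- Let $p$ be a prime number and let $R$ be a commutative ring of characteristic $p$. For an $R$-module $N$ and $e \ge 0$ let $F^e_*N$ denote the abelian group $N$ on which $x \in R$ acts as multiplication by $x^{p^e}$. Assume that $R$ is $F$-finite, i.e. $R$ is noetherian and $F_*R$ is a finitely generated $R$-module. For a finitely generated module $N$ over a complete noetherian local ring, let $\mathcal{J}(N)$ denote the finite set of isomorphism classes of the indecomposable modules that occur in a decomposition of $N$ as a finite direct sum of indecomposables (well defined by the Krull–Schmidt theorem). Assume that $R$ has complete local finite $F$-representation type (CL-FFRT), i.e. for every prime ideal $\mathfrak{p} \subseteq R$ the set $\bigcup_{e \ge 0} \mathcal{J}(F^e_*\widehat{R_\mathfrak{p}})$ of isomorphism classes of $\widehat{R_\mathfrak{p}}$-modules is finite. Let $a \ge 0$ and $b > 0$ be integers such that for every prime ideal $\mathfrak{p} \subseteq R$ $$\mathcal{J}(F^a_*\widehat{R_\mathfrak{p}}) = \mathcal{J}(F^{a+b}_*\widehat{R_\mathfrak{p}}) = \mathcal{J}(F^{a+2b}_*\widehat{R_\mathfrak{p}}) = \cdots .$$ Put $F^{(i)} := F^{a+ib}$ and $\mathcal{D}^{(0)}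 := \operatorname{End}_R(F^{(0)}_*R)$, and let $$\mathcal{D}^{(0)}\langle\Phi\rangle := \bigoplus_{i \ge 0} \operatorname{Hom}_R(F^{(0)}_*R, F^{(i)}_*R)$$ be the graded ring whose multiplication is composition of additive maps $R \to R$. Its degree $0$ part is $\mathcal{D}^{(0)}$, and $R$ maps to $\mathcal{D}^{(0)}$ by $r \mapsto (\text{multiplication by } r)$; in this way every left $\mathcal{D}^{(0)}\langle\Phi\rangle$-module is an $R$-module. A left $\mathcal{D}^{(0)}\langle\Phi\rangle$-module $M$ is called unit if the natural map $$\operatorname{Hom}_R(F^{(0)}_*R, F^{(1)}_*R) \otimes_{\mathcal{D}^{(0)}} M \to M, \qquad \varphi \otimes m \mapsto \varphi \cdot m,$$ is an isomorphism. Theorem. Let $M$ be a left $\mathcal{D}^{(0)}\langle\Phi\rangle$-module that is finitely generated and unit. Then $M$, viewed as an $R$-module, has only finitely many associated primes. -/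

import Mathlib

open CategoryTheory TensorProduct
open scoped DirectSum

universe u v w

noncomputable section

namespace FFRT

/-! ### Frobenius pushforwards -/

section Frobenius

/-- The Frobenius pushforward `F^e_* M`: the abelian group `M`, on which `x : R` acts as
multiplication by `x ^ (p ^ e)`. -/
def FrobPush (_p _e : ℕ) (M : Type u) : Type u := M

instance (p e : ℕ) (M : Type u) [AddCommGroup M] : AddCommGroup (FrobPush p e M) :=
  inferInstanceAs (AddCommGroup M)

instance (p e : ℕ) (R : Type v) (M : Type u) [CommRing R] [ExpChar R p] [AddCommGroup M]
    [Module R M] : Module R (FrobPush p e M) :=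
  Module.compHom (R := R) M (iterateFrobenius R p e)

/-- A ring of characteristic `p` is `F`-finite if it is noetherian and `F_* R` is a finitely
generated `R`-module. -/
structure IsFFinite (p : ℕ) (R : Type u) [CommRing R] [ExpChar R p] : Prop where
  noetherian : IsNoetherianRing R
  finite : Module.Finite R (FrobPush p 1 R)

end Frobenius

/-! ### Finite `F`-representation type -/

section RepresentationType

/-- Isomorphism classes of `R`-modules. -/
abbrev IsoClass (R : Type u) [CommRing R] : Type (u + 1) :=
  Quotient (isIsomorphicSetoid (ModuleCat.{u} R))

/-- The set `𝒥(M)` of isomorphism classes of the indecomposable modules that occur in a decomposition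
of `M` as a finite direct sum of indecomposable modules. It is used for finitely generated modules
over complete noetherian local rings, where such a decomposition exists and is unique up to
isomorphism and order. -/
def indecomposables (R : Type u) [CommRing R] (M : Type u) [AddCommGroup M] [Module R M] :
    Set (IsoClass R) :=
  {c | ∃ (n : ℕ) (N : Fin n → ModuleCat.{u} R), (∀ i, Indecomposable (N i)) ∧
    Nonempty (M ≃ₗ[R] ((i : Fin n) → N i)) ∧
    ∃ i, c = Quotient.mk (isIsomorphicSetoid (ModuleCat.{u} R)) (N i)}

/-- Finite `F`-representation type, for a complete local `F`-finite ring `S` of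
characteristic `p`. -/
def HasFFRT (p : ℕ) (S : Type u) [CommRing S] [ExpChar S p] : Prop :=
  (⋃ e : ℕ, indecomposables S (FrobPush p e S)).Finite

/-- The completion of the local ring `R_P` at its maximal ideal. -/
abbrev LocalCompletion {R : Type u} [CommRing R] (P : Ideal R) [P.IsPrime] : Type u :=
  AdicCompletion (IsLocalRing.maximalIdeal (Localization.AtPrime P)) (Localization.AtPrime P)

instance (p : ℕ) [Fact p.Prime] {R : Type u} [CommRing R] [CharP R p] (P : Ideal R) [P.IsPrime] :
    CharP (LocalCompletion P) p := by
  have h : Nontrivial (LocalCompletion P) := by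
    have : Nontrivial (Localization.AtPrime P ⧸ IsLocalRing.maximalIdeal (Localization.AtPrime P)) :=
      Ideal.Quotient.nontrivial_iff.2 (IsLocalRing.maximalIdeal.isMaximal _).ne_top
    exact (AdicCompletion.evalOneₐ
      (IsLocalRing.maximalIdeal (Localization.AtPrime P))).toRingHom.domain_nontrivial
  refine (CharP.charP_iff_prime_eq_zero Fact.out).2 ?_
  have h0 : (p : R) = 0 := CharP.cast_eq_zero R p
  have h1 := congrArg (algebraMap (Localization.AtPrime P) (LocalCompletion P))
    (congrArg (algebraMap R (Localization.AtPrime P)) h0)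
  simpa only [map_natCast, map_zero] using h1

/-- Complete local finite `F`-representation type (CL-FFRT): `R` is `F`-finite and the completion of
`R_P` has FFRT for every prime ideal `P`. -/
structure IsCLFFRT (p : ℕ) [Fact p.Prime] (R : Type u) [CommRing R] [CharP R p] : Prop where
  fFinite : IsFFinite p R
  ffrt : ∀ (P : Ideal R) [P.IsPrime], HasFFRT p (LocalCompletion P)

/-- The condition on the integers `a` and `b > 0`: for every prime ideal `P`, the modules
`F^a_* S, F^(a+b)_* S, F^(a+2b)_* S, …` over the completion `S` of `R_P` have the same
indecomposable summands. -/
structure IsFFRTPair (p : ℕ) [Fact p.Prime] (R : Type u) [CommRing R] [CharP R p] (a b : ℕ) :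
    Prop where
  pos : 0 < b
  eq : ∀ (P : Ideal R) [P.IsPrime] (e : ℕ),
    indecomposables (LocalCompletion P) (FrobPush p (a + e * b) (LocalCompletion P)) =
      indecomposables (LocalCompletion P) (FrobPush p a (LocalCompletion P))

end RepresentationType

/-! ### The rings `𝒟^(0)` and `𝒟^(0)⟨Φ⟩` -/

section Ring

variable (p : ℕ) (R : Type u) [CommRing R]

/-- `Hom_R(F^i_* R, F^j_* R)`, as the additive group of all additive maps `φ : R → R` with
`φ (x ^ (p ^ i) * y) = x ^ (p ^ j) * φ y`. -/
def frobHom (i j : ℕ) : AddSubgroup (AddMonoid.End R) where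
  carrier := {φ | ∀ x y : R, φ (x ^ p ^ i * y) = x ^ p ^ j * φ y}
  add_mem' {φ ψ} hφ hψ x y := by
    change φ _ + ψ _ = _ * (φ y + ψ y)
    rw [hφ, hψ, mul_add]
  zero_mem' x y := (mul_zero _).symm
  neg_mem' {φ} hφ x y := by
    change - φ _ = _ * (- φ y)
    rw [hφ, mul_neg]

variable {R} in
theorem mem_frobHom {i j : ℕ} {φ : AddMonoid.End R} :
    φ ∈ frobHom p R i j ↔ ∀ x y : R, φ (x ^ p ^ i * y) = x ^ p ^ j * φ y := Iff.rfl

/-- `frobHom p R i j` is the group of `R`-linear maps `F^i_* R → F^j_* R`. -/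
def frobHomEquiv (i j : ℕ) [ExpChar R p] :
    (FrobPush p i R →ₗ[R] FrobPush p j R) ≃+ frobHom p R i j where
  toFun f := ⟨f.toAddMonoidHom, fun x y => map_smul f x (show FrobPush p i R from y)⟩
  invFun φ := { toFun := φ.1, map_add' := φ.1.map_add, map_smul' := fun x y => φ.2 x y }
  left_inv _ := rfl
  right_inv _ := rfl
  map_add' _ _ := rfl

/-- `𝒟^e = End_R(F^e_* R)`, the ring of differential operators of level `e`, as a subring of the
ring of additive endomorphisms of `R`. -/
def diffOp (e : ℕ) : Subring (AddMonoid.End R) where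
  __ := frobHom p R e e
  mul_mem' {φ ψ} hφ hψ x y := by
    change φ (ψ _) = _ * φ (ψ y)
    rw [hψ x y, hφ]
  one_mem' _ _ := rfl

/-- `R` acts on itself by multiplication, through operators in `𝒟^e`. -/
def toDiffOp (e : ℕ) : R →+* diffOp p R e where
  toFun r := ⟨AddMonoidHom.mulLeft r, fun _ y => mul_left_comm r _ y⟩
  map_one' := Subtype.ext (AddMonoidHom.ext fun y => one_mul y)
  map_mul' r s := Subtype.ext (AddMonoidHom.ext fun y => mul_assoc r s y)
  map_zero' := Subtype.ext (AddMonoidHom.ext fun y => zero_mul y)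
  map_add' r s := Subtype.ext (AddMonoidHom.ext fun y => add_mul r s y)

/-- The right action of `𝒟^i` on `Hom_R(F^i_* R, F^j_* R)` by precomposition. -/
instance (i j : ℕ) : Module (diffOp p R i)ᵐᵒᵖ (frobHom p R i j) where
  smul d φ := ⟨φ.1 * d.unop.1, fun x y => by
    change φ.1 (d.unop.1 _) = _ * φ.1 (d.unop.1 y)
    rw [d.unop.2 x y, φ.2]⟩
  one_smul φ := Subtype.ext (mul_one φ.1)
  mul_smul d d' φ := Subtype.ext (mul_assoc φ.1 d'.unop.1 d.unop.1).symm
  smul_zero d := Subtype.ext (zero_mul d.unop.1)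
  smul_add d φ ψ := Subtype.ext (add_mul φ.1 ψ.1 d.unop.1)
  add_smul d d' φ := Subtype.ext (mul_add φ.1 d.unop.1 d'.unop.1)
  zero_smul φ := Subtype.ext (mul_zero φ.1)

variable (a b : ℕ)

/-- The homogeneous pieces `Hom_R(F^(0)_* R, F^(i)_* R)`, where `F^(i) = F^(a + i b)`. -/
abbrev homPiece (i : ℕ) : AddSubgroup (AddMonoid.End R) := frobHom p R a (a + i * b)

instance : SetLike.GradedMonoid (homPiece p R a b) where
  one_mem _ _ := by simp
  mul_mem i j φ ψ hφ hψ x y := by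
    change φ (ψ _) = _ * φ (ψ y)
    rw [hψ x y, show x ^ p ^ (a + j * b) = (x ^ p ^ (j * b)) ^ p ^ a by
      rw [← pow_mul, ← pow_add, add_comm a], hφ, ← pow_mul, ← pow_add]
    congr 3
    ring

/-- The ring `𝒟^(0)⟨Φ⟩ = ⨁_{i ≥ 0} Hom_R(F^(0)_* R, F^(i)_* R)`, with composition as
multiplication. -/
abbrev DPhi : Type u := ⨁ i : ℕ, homPiece p R a b i

/-- The inclusion of `𝒟^(0) = 𝒟^a` in `𝒟^(0)⟨Φ⟩` as the piece of degree `0`. -/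
def diffOpToDPhi : diffOp p R a →+* DPhi p R a b where
  toFun d := DirectSum.of (fun i => homPiece p R a b i) 0 ⟨d.1, fun x y => by simpa using d.2 x y⟩
  map_one' := rfl
  map_mul' d d' := by
    refine Eq.trans ?_ (DirectSum.of_mul_of (A := fun i => homPiece p R a b i) _ _).symm
    rfl
  map_zero' := (DirectSum.of (fun i => homPiece p R a b i) 0).map_zero
  map_add' d d' := by
    rw [← map_add]
    rfl

/-- The ring homomorphism `R → 𝒟^(0)⟨Φ⟩` sending `r` to multiplication by `r`, in degree `0`. -/
def baseToDPhi : R →+* DPhi p R a b := (diffOpToDPhi p R a b).comp (toDiffOp p R a)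

/-- `Hom_R(F^(0)_* R, F^(1)_* R)`. -/
abbrev homOne : AddSubgroup (AddMonoid.End R) := homPiece p R a b 1

end Ring

/-! ### Unit modules -/

section Unit

/-- The tensor product `H ⊗_A M` of a right module `H` and a left module `M` over a possibly
noncommutative ring `A`: the quotient of `H ⊗_ℤ M` by the relations `h d ⊗ m = h ⊗ d m`. -/
abbrev NCTensor (A : Type u) [Ring A] (H : Type v) [AddCommGroup H] [Module Aᵐᵒᵖ H]
    (M : Type w) [AddCommGroup M] [Module A M] : Type (max v w) :=
  (H ⊗[ℤ] M) ⧸ Submodule.span ℤ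
    {t : H ⊗[ℤ] M | ∃ (h : H) (d : A) (m : M),
      t = (MulOpposite.op d • h) ⊗ₜ[ℤ] m - h ⊗ₜ[ℤ] (d • m)}

variable (p : ℕ) (R : Type u) [CommRing R] (a b : ℕ) (M : Type v) [AddCommGroup M]
  [Module (DPhi p R a b) M]

/-- A left `𝒟^(0)⟨Φ⟩`-module as a left `𝒟^(0)`-module. -/
abbrev moduleDiffOp : Module (diffOp p R a) M := Module.compHom M (diffOpToDPhi p R a b)

/-- A left `𝒟^(0)⟨Φ⟩`-module as an `R`-module. -/
abbrev moduleBase : Module R M := Module.compHom M (baseToDPhi p R a b)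

/-- `Φ^* M = Hom_R(F^(0)_* R, F^(1)_* R) ⊗_{𝒟^(0)} M`. -/
abbrev PhiPullback : Type (max u v) :=
  letI := moduleDiffOp p R a b M
  NCTensor (diffOp p R a) (homOne p R a b) M

/-- The map `Hom_R(F^(0)_* R, F^(1)_* R) ⊗_ℤ M → M` with `φ ⊗ m ↦ φ m`. -/
def preStructureMap : (homOne p R a b) ⊗[ℤ] M →ₗ[ℤ] M :=
  TensorProduct.lift (LinearMap.mk₂ ℤ
    (fun (φ : homOne p R a b) (m : M) =>
      DirectSum.of (fun i => homPiece p R a b i) 1 φ • m)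
    (fun φ ψ m => by rw [map_add, add_smul])
    (fun n φ m => by
      rw [map_zsmul]
      exact map_zsmul ((smulAddHom (DPhi p R a b) M).flip m) n _)
    (fun φ m m' => smul_add _ m m')
    (fun n φ m => smul_comm _ n m))

/-- The natural map `ψ_M : Φ^* M → M` with `φ ⊗ m ↦ φ m`. -/
def structureMap : PhiPullback p R a b M →ₗ[ℤ] M :=
  letI := moduleDiffOp p R a b M
  Submodule.liftQ _ (preStructureMap p R a b M) <| by
    rw [Submodule.span_le]
    rintro _ ⟨φ, d, m, rfl⟩
    rw [SetLike.mem_coe, LinearMap.mem_ker, map_sub, sub_eq_zero]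
    change DirectSum.of (fun i => homPiece p R a b i) 1 (MulOpposite.op d • φ) • m =
      DirectSum.of (fun i => homPiece p R a b i) 1 φ • (diffOpToDPhi p R a b d • m)
    rw [← mul_smul]
    congr 1
    change _ = DirectSum.of (fun i => homPiece p R a b i) 1 φ *
      DirectSum.of (fun i => homPiece p R a b i) 0 _
    rw [DirectSum.of_mul_of]
    rfl

/-- A left `𝒟^(0)⟨Φ⟩`-module `M` is unit if the natural map `Φ^* M → M` is an isomorphism. -/
def IsUnitModule : Prop := Function.Bijective (structureMap p R a b M)

end Unit

end FFRT

end

/-!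
The proof rests on one consequence of the hypothesis on the indecomposable summands: there are
`R`-linear maps `φ_k : F^(0)_* R → F^(1)_* R` and `ψ_k : F^(1)_* R → F^(0)_* R` with
`∑ φ_k ψ_k = 1`, that is, `F^(1)_* R` is a direct summand of a finite power of `F^(0)_* R`. Over the
complete local ring `B` at a prime this follows by decomposing `F^(1)_* B` into indecomposable
modules, each of which is a summand of `F^(0)_* B`
(`id_mem_factorThrough_of_indecomposables_subset`). It descends to `R` because `R → B` is flat,
Frobenius pushforwards commute with localization and completion
(`isBaseChange_frobPushAlgebraMap_localCompletion`), and so does `Hom` between finitely presented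
modules: the elements `r` such that `r • id` is a sum of endomorphisms factoring through `F^(0)_* R`
form an ideal contained in no maximal ideal (`id_mem_factorThrough_frobPush`).

Write `H_i = Hom_R(F^(0)_* R, F^(i)_* R)`. The unit condition `M ≅ H_1 ⊗ M` lets `ψ_k` act on `M` by
`ψ_k (φ m) = (ψ_k φ) m` (`exists_backward_action`), and then `m = ∑ φ_k (ψ_k m)` for all `m`. For a
`𝒟^(0)`-submodule `N` of `M` this gives `Ass (H_1 N) ⊆ Ass N`
(`IsRadicalAnnihilatorIn.of_frobSpan`): if the annihilator of `y ∈ H_1 N` has radical `P`, then the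
elements `ψ_k y` of `N` are killed by powers of all elements of `P`, and they are not all killed by
elements outside `P`, since `s ^ (p ^ (a + b)) y = ∑ φ_k (s ^ (p ^ a) ψ_k y)`.

Finally, let `N_t` be the sum of the groups `H_i g` for `i ≤ t` and `g` in a finite generating set.
Surjectivity of `H_1 ⊗ M → M`, together with `H_{i+1} = H_1 H_i` (`homOf_eq_sum`), gives
`N_{t+1} ⊆ H_1 N_t` for all large `t`. Hence `Ass M = ⋃ Ass N_t` is contained in `Ass N_{t₀}` for a
single `t₀`, and `N_{t₀}` lies in a finitely generated module over the noetherian ring `R`.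
-/

namespace FFRT

/-! ### Maps factoring through another module -/

section Factor

variable {S : Type*} [CommRing S]

/-- The trace of `Y` in `End_S X`: the submodule spanned by the endomorphisms of `X` that factor
through `Y`. It contains the identity exactly when `X` is a direct summand of a finite power
of `Y`. -/
def factorThrough (S X Y : Type*) [CommRing S] [AddCommGroup X] [Module S X] [AddCommGroup Y]
    [Module S Y] : Submodule S (X →ₗ[S] X) :=
  Submodule.span S (Set.range fun c : (Y →ₗ[S] X) × (X →ₗ[S] Y) => c.1 ∘ₗ c.2)

variable {X Y : Type*} [AddCommGroup X] [Module S X] [AddCommGroup Y] [Module S Y]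

theorem comp_mem_factorThrough (β : Y →ₗ[S] X) (α : X →ₗ[S] Y) :
    β ∘ₗ α ∈ factorThrough S X Y :=
  Submodule.subset_span ⟨(β, α), rfl⟩

theorem id_mem_factorThrough_congr {X' Y' : Type*} [AddCommGroup X'] [Module S X']
    [AddCommGroup Y'] [Module S Y'] (eX : X ≃ₗ[S] X') (eY : Y ≃ₗ[S] Y')
    (h : LinearMap.id ∈ factorThrough S X Y) : LinearMap.id ∈ factorThrough S X' Y' := by
  have key : factorThrough S X Y ≤ (factorThrough S X' Y').comap eX.conj.toLinearMap := by
    refine Submodule.span_le.2 ?_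
    rintro _ ⟨⟨β, α⟩, rfl⟩
    have : eX.conj (β ∘ₗ α) =
        (eX.toLinearMap ∘ₗ β ∘ₗ eY.symm.toLinearMap) ∘ₗ
          (eY.toLinearMap ∘ₗ α ∘ₗ eX.symm.toLinearMap) := by
      ext x
      simp [LinearEquiv.conj_apply]
    rw [SetLike.mem_coe, Submodule.mem_comap]
    exact this ▸ comp_mem_factorThrough _ _
  have := key h
  rw [Submodule.mem_comap] at this
  simpa using this

theorem exists_sum_comp_eq_id (h : LinearMap.id ∈ factorThrough S X Y) :
    ∃ (n : ℕ) (β : Fin n → Y →ₗ[S] X) (α : Fin n → X →ₗ[S] Y),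
      ∑ k, β k ∘ₗ α k = LinearMap.id := by
  obtain ⟨n, c, g, hg⟩ := Submodule.mem_span_set'.1 h
  choose γ hγ using fun k => (g k).2
  refine ⟨n, fun k => c k • (γ k).1, fun k => (γ k).2, ?_⟩
  rw [← hg]
  exact Finset.sum_congr rfl fun k _ => by rw [← hγ k, LinearMap.smul_comp]

end Factor

/-! ### Descent along flat base change -/

section Descent

variable {R : Type*} [CommRing R] {B : Type*} [CommRing B] [Algebra R B] [Module.Flat R B]

/-- If `1 ⊗ q` vanishes after a flat base change `R → B`, then the annihilator of `q` generates the
unit ideal of `B`, and is therefore not contained in the kernel of a homomorphism to a nontrivial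
`B`-algebra. -/
theorem exists_smul_eq_zero_of_tmul_eq_zero {k : Type*} [CommRing k] [Nontrivial k] [Algebra R k]
    (f : B →ₐ[R] k) {Q : Type*} [AddCommGroup Q] [Module R Q] (q : Q)
    (hq : (1 : B) ⊗ₜ[R] q = 0) : ∃ r : R, r • q = 0 ∧ algebraMap R k r ≠ 0 := by
  by_contra! hcon
  let I : Ideal R := LinearMap.ker (LinearMap.toSpanSingleton R Q q)
  let g : (R ⧸ I) →ₗ[R] Q := I.liftQ (LinearMap.toSpanSingleton R Q q) le_rfl
  have hg : Function.Injective g := LinearMap.ker_eq_bot.1 (Submodule.ker_liftQ_eq_bot _ _ _ le_rfl)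
  have h1 : (1 : B) ⊗ₜ[R] (1 : R ⧸ I) = 0 := by
    apply Module.Flat.lTensor_preserves_injective_linearMap (M := B) g hg
    rw [LinearMap.lTensor_tmul, map_zero]
    have : g 1 = q := by
      change LinearMap.toSpanSingleton R Q q 1 = q
      rw [LinearMap.toSpanSingleton_apply, one_smul]
    rw [this, hq]
  let h : (R ⧸ I) →ₐ[R] k := Ideal.Quotient.liftₐ I (Algebra.ofId R k) fun r hr => by
    refine hcon r ?_
    simpa [I] using hr
  have h2 := congrArg (Algebra.TensorProduct.productMap f h) h1
  rw [map_zero, Algebra.TensorProduct.productMap_apply_tmul, map_one, map_one, mul_one] at h2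
  exact one_ne_zero h2

variable {X Y : Type*} [AddCommGroup X] [Module R X] [AddCommGroup Y] [Module R Y]

/-- `Hom` out of a finitely presented module commutes with flat base change, so the trace of `Y` in
`End X` does as well. -/
theorem one_tmul_id_mem_baseChange [Module.FinitePresentation R X] [Module.FinitePresentation R Y]
    (h : LinearMap.id ∈ factorThrough B (B ⊗[R] X) (B ⊗[R] Y)) :
    (1 : B) ⊗ₜ[R] (LinearMap.id : X →ₗ[R] X) ∈ (factorThrough R X Y).baseChange B := by
  have hXX := Module.FinitePresentation.isBaseChange_map R X X B
  have hXY := Module.FinitePresentation.isBaseChange_map R X Y B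
  have hYX := Module.FinitePresentation.isBaseChange_map R Y X B
  have key : factorThrough B (B ⊗[R] X) (B ⊗[R] Y) ≤
      ((factorThrough R X Y).baseChange B).map hXX.equiv.toLinearMap := by
    refine Submodule.span_le.2 ?_
    rintro _ ⟨⟨β, α⟩, rfl⟩
    change β ∘ₗ α ∈ _
    refine hXY.inductionOn α _ ?_ (fun α => ?_) (fun c α hα => ?_) (fun α α' hα hα' => ?_)
    · rw [LinearMap.comp_zero]; exact zero_mem _
    · refine hYX.inductionOn β _ ?_ (fun β => ?_) (fun c β hβ => ?_) (fun β β' hβ hβ' => ?_)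
      · rw [LinearMap.zero_comp]; exact zero_mem _
      · refine ⟨1 ⊗ₜ (β ∘ₗ α),
          Submodule.tmul_mem_baseChange_of_mem 1 (comp_mem_factorThrough β α), ?_⟩
        rw [LinearEquiv.coe_coe, IsBaseChange.equiv_tmul, one_smul]
        simp [LinearMap.baseChange_comp]
      · rw [LinearMap.smul_comp]; exact Submodule.smul_mem _ _ hβ
      · rw [LinearMap.add_comp]; exact add_mem hβ hβ'
    · rw [LinearMap.comp_smul]; exact Submodule.smul_mem _ _ hα
    · rw [LinearMap.comp_add]; exact add_mem hα hα'
  obtain ⟨t, ht, hte⟩ := key h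
  have : t = 1 ⊗ₜ LinearMap.id := by
    apply hXX.equiv.injective
    rw [IsBaseChange.equiv_tmul, one_smul]
    simpa using hte
  exact this ▸ ht

/-- If `X` is a direct summand of a finite power of `Y` after a flat base change to `B`, then for
each `B`-algebra `k` some element of `R` that does not vanish in `k` multiplies `X` by a sum of
endomorphisms factoring through `Y`. -/
theorem exists_smul_id_mem_factorThrough {k : Type*} [CommRing k] [Nontrivial k] [Algebra R k]
    (f : B →ₐ[R] k) [Module.FinitePresentation R X] [Module.FinitePresentation R Y]
    {X' Y' : Type*} [AddCommGroup X'] [Module R X'] [Module B X'] [IsScalarTower R B X']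
    [AddCommGroup Y'] [Module R Y'] [Module B Y'] [IsScalarTower R B Y']
    {i : X →ₗ[R] X'} (hi : IsBaseChange B i) {j : Y →ₗ[R] Y'} (hj : IsBaseChange B j)
    (h : LinearMap.id ∈ factorThrough B X' Y') :
    ∃ r : R, r • LinearMap.id ∈ factorThrough R X Y ∧ algebraMap R k r ≠ 0 := by
  have h1 := one_tmul_id_mem_baseChange
    (id_mem_factorThrough_congr hi.equiv.symm hj.equiv.symm h)
  have h2 : (1 : B) ⊗ₜ[R] (factorThrough R X Y).mkQ LinearMap.id = 0 := by
    have h3 : (factorThrough R X Y).baseChange B ≤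
        LinearMap.ker ((factorThrough R X Y).mkQ.baseChange B) := by
      rw [Submodule.baseChange_eq_span, Submodule.span_le]
      rintro _ ⟨t, ht, rfl⟩
      simp [(Submodule.Quotient.mk_eq_zero _).2 ht]
    simpa using h3 h1
  obtain ⟨r, hr, hrk⟩ := exists_smul_eq_zero_of_tmul_eq_zero f _ h2
  refine ⟨r, ?_, hrk⟩
  rwa [← map_smul, Submodule.mkQ_apply, Submodule.Quotient.mk_eq_zero] at hr

end Descent

/-! ### Decompositions into indecomposable modules -/

section Indecomposable

variable {S : Type u} [CommRing S] [IsLocalRing S]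

open IsLocalRing in
/-- A finitely generated module over a local ring is a finite direct sum of indecomposable modules:
a proper decomposition lowers the dimension of the fibre at the closed point. -/
theorem exists_linearEquiv_pi_indecomposable (N : ModuleCat.{u} S) [Module.Finite S N] :
    ∃ (n : ℕ) (L : Fin n → ModuleCat.{u} S), (∀ i, Indecomposable (L i)) ∧
      Nonempty (N ≃ₗ[S] ((i : Fin n) → L i)) := by
  induction hd : Module.finrank (ResidueField S) (ResidueField S ⊗[S] N) using
    Nat.strong_induction_on generalizing N with
  | _ d ih =>
    by_cases hN : Limits.IsZero N
    · have := ModuleCat.isZero_iff_subsingleton.1 hN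
      exact ⟨0, Fin.elim0, fun i => i.elim0, ⟨0⟩⟩
    by_cases hI : Indecomposable N
    · exact ⟨1, fun _ => N, fun _ => hI, ⟨(LinearEquiv.funUnique (Fin 1) S N).symm⟩⟩
    simp only [Indecomposable, hN, not_false_eq_true, true_and, not_forall, not_or] at hI
    obtain ⟨Y, Z, e, hY, hZ⟩ := hI
    let e' : N ≃ₗ[S] Y × Z := (e ≪≫ ModuleCat.biprodIsoProd Y Z).toLinearEquiv
    have hYf : Module.Finite S Y := Module.Finite.of_surjective
      (LinearMap.fst S Y Z ∘ₗ e'.toLinearMap) (Prod.fst_surjective.comp e'.surjective)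
    have hZf : Module.Finite S Z := Module.Finite.of_surjective
      (LinearMap.snd S Y Z ∘ₗ e'.toLinearMap) (Prod.snd_surjective.comp e'.surjective)
    have hfree : ∀ W : ModuleCat.{u} S, Module.Free (ResidueField S) (ResidueField S ⊗[S] W) :=
      fun W => Module.Free.of_divisionRing _ _
    have pos : ∀ W : ModuleCat.{u} S, Module.Finite S W → ¬Limits.IsZero W →
        0 < Module.finrank (ResidueField S) (ResidueField S ⊗[S] W) := by
      intro W _ hW
      rw [ModuleCat.isZero_iff_subsingleton, ← subsingleton_tensorProduct (R := S),
        not_subsingleton_iff_nontrivial] at hW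
      have := hfree W
      exact (Module.finrank_pos_iff_of_free _ _).2 hW
    have hsum : Module.finrank (ResidueField S) (ResidueField S ⊗[S] N) =
        Module.finrank (ResidueField S) (ResidueField S ⊗[S] Y) +
          Module.finrank (ResidueField S) (ResidueField S ⊗[S] Z) := by
      have := hfree Y
      have := hfree Z
      rw [← Module.finrank_prod]
      exact ((e'.baseChange S (ResidueField S) _ _) ≪≫ₗ
        TensorProduct.prodRight S (ResidueField S) (ResidueField S) Y Z).finrank_eq
    have hYp := pos Y hYf hY
    have hZp := pos Z hZf hZ
    obtain ⟨n, L, hL, ⟨eL⟩⟩ := ih _ (by omega) Y rfl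
    obtain ⟨m, K, hK, ⟨eK⟩⟩ := ih _ (by omega) Z rfl
    let T : Fin n ⊕ Fin m → ModuleCat.{u} S := Sum.elim L K
    refine ⟨n + m, fun i => T (finSumFinEquiv.symm i), fun i => ?_, ⟨?_⟩⟩
    · change Indecomposable (T (finSumFinEquiv.symm i))
      rcases finSumFinEquiv.symm i with i | i
      · exact hL i
      · exact hK i
    · exact e' ≪≫ₗ LinearEquiv.prodCongr eL eK ≪≫ₗ
        (LinearEquiv.sumPiEquivProdPi S (Fin n) (Fin m) (fun i => T i)).symm ≪≫ₗ
        LinearEquiv.piCongrLeft' S (fun i => T i) finSumFinEquiv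

/-- If every indecomposable summand of `N` is one of `N'`, then `N` is a direct summand of a finite
power of `N'`. -/
theorem id_mem_factorThrough_of_indecomposables_subset (N N' : Type u) [AddCommGroup N] [Module S N]
    [AddCommGroup N'] [Module S N'] [Module.Finite S N]
    (h : indecomposables S N ⊆ indecomposables S N') :
    LinearMap.id ∈ factorThrough S N N' := by
  classical
  have : Module.Finite S (ModuleCat.of S N) := inferInstanceAs (Module.Finite S N)
  obtain ⟨n, L, hL, ⟨e⟩⟩ := exists_linearEquiv_pi_indecomposable (ModuleCat.of S N)
  have hsum : (LinearMap.id : N →ₗ[S] N) = ∑ i : Fin n,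
      (e.symm.toLinearMap ∘ₗ LinearMap.single S (fun i => L i) i) ∘ₗ
        (LinearMap.proj i ∘ₗ e.toLinearMap) := by
    refine LinearMap.ext fun x => e.injective ?_
    rw [LinearMap.sum_apply, map_sum]
    simp only [LinearMap.coe_comp, Function.comp_apply, LinearEquiv.coe_coe,
      LinearEquiv.apply_symm_apply, LinearMap.id_apply, LinearMap.coe_single, LinearMap.proj_apply]
    exact (Finset.univ_sum_single (e x)).symm
  rw [hsum]
  refine Submodule.sum_mem _ fun i _ => ?_
  obtain ⟨m, K, -, ⟨e'⟩, j, hj⟩ := h ⟨n, L, hL, ⟨e⟩, i, rfl⟩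
  obtain ⟨f⟩ : Nonempty (L i ≅ K j) := Quotient.exact hj
  -- The identity of `L i` factors through `N'`, as `L i ≅ K j` and `N' ≅ ∏ K`.
  have hid : (LinearMap.proj j ∘ₗ e'.toLinearMap) ∘ₗ
      (e'.symm.toLinearMap ∘ₗ LinearMap.single S (fun i => K i) j) = LinearMap.id := by
    ext x
    simp
  have hf : (f.toLinearEquiv.symm.toLinearMap ∘ₗ (LinearMap.proj j ∘ₗ e'.toLinearMap)) ∘ₗ
      ((e'.symm.toLinearMap ∘ₗ LinearMap.single S (fun i => K i) j) ∘ₗ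
        f.toLinearEquiv.toLinearMap) = LinearMap.id := by
    rw [LinearMap.comp_assoc, ← LinearMap.comp_assoc _ _ (LinearMap.proj j ∘ₗ e'.toLinearMap), hid]
    ext x
    simp
  have h3 : (e.symm.toLinearMap ∘ₗ LinearMap.single S (fun i => L i) i) ∘ₗ
        (LinearMap.proj i ∘ₗ e.toLinearMap) =
      ((e.symm.toLinearMap ∘ₗ LinearMap.single S (fun i => L i) i) ∘ₗ
        (f.toLinearEquiv.symm.toLinearMap ∘ₗ (LinearMap.proj j ∘ₗ e'.toLinearMap))) ∘ₗ
      (((e'.symm.toLinearMap ∘ₗ LinearMap.single S (fun i => K i) j) ∘ₗ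
        f.toLinearEquiv.toLinearMap) ∘ₗ (LinearMap.proj i ∘ₗ e.toLinearMap)) := by
    rw [LinearMap.comp_assoc _ _ (e.symm.toLinearMap ∘ₗ LinearMap.single S (fun i => L i) i),
      ← LinearMap.comp_assoc (LinearMap.proj i ∘ₗ e.toLinearMap), hf, LinearMap.id_comp]
  exact h3 ▸ comp_mem_factorThrough _ _

end Indecomposable

/-! ### Base change of Frobenius pushforwards -/

section FrobeniusBaseChange

section General

variable (p e : ℕ)

/-- The identity of `M`, as an additive equivalence from `M` to `F^e_* M`. -/
def toFrob (M : Type*) [AddCommGroup M] : M ≃+ FrobPush p e M := AddEquiv.refl M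

variable {R : Type*} [CommRing R] [ExpChar R p]

theorem smul_toFrob {M : Type*} [AddCommGroup M] [Module R M] (r : R) (x : M) :
    r • toFrob p e M x = toFrob p e M (r ^ p ^ e • x) := rfl

theorem finite_frobPush (h : Module.Finite R (FrobPush p 1 R)) :
    Module.Finite R (FrobPush p e R) := by
  have h1 : (iterateFrobenius R p 1).Finite := h
  suffices h2 : (iterateFrobenius R p e).Finite from h2
  induction e with
  | zero => rw [iterateFrobenius_zero]; exact RingHom.Finite.id R
  | succ e ih => rw [iterateFrobenius_add]; exact ih.comp h1

variable (R) in
/-- The map `F^e_* R → F^e_* A` induced by the structure map of an `R`-algebra `A`. -/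
def frobPushAlgebraMap (A : Type*) [CommRing A] [Algebra R A] :
    FrobPush p e R →ₗ[R] FrobPush p e A where
  toFun x := toFrob p e A (algebraMap R A ((toFrob p e R).symm x))
  map_add' x y := by simp only [map_add]
  map_smul' r x := by
    obtain ⟨x, rfl⟩ := (toFrob p e R).surjective x
    rw [smul_toFrob, AddEquiv.symm_apply_apply, AddEquiv.symm_apply_apply, RingHom.id_apply,
      smul_toFrob, smul_eq_mul, map_mul, Algebra.smul_def]

theorem frobPushAlgebraMap_toFrob {A : Type*} [CommRing A] [Algebra R A] (x : R) :
    frobPushAlgebraMap p e R A (toFrob p e R x) = toFrob p e A (algebraMap R A x) := rfl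

instance {A M : Type*} [CommRing A] [ExpChar A p] [Algebra R A] [AddCommGroup M] [Module R M]
    [Module A M] [IsScalarTower R A M] : IsScalarTower R A (FrobPush p e M) where
  smul_assoc r a x := by
    obtain ⟨x, rfl⟩ := (toFrob p e M).surjective x
    simp only [smul_toFrob]
    rw [smul_pow, smul_assoc]

end General

/-- Localizing `F^e_* R` at the powers `s ^ (p ^ e)` is the same as localizing at the elements
`s`. -/
theorem isLocalizedModule_frobPushAlgebraMap (p e : ℕ) [Fact p.Prime] {R : Type*} [CommRing R]
    [ExpChar R p] (S : Submonoid R) (A : Type*) [CommRing A] [Algebra R A] [IsLocalization S A] :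
    IsLocalizedModule S (frobPushAlgebraMap p e R A) where
  map_units s := by
    rw [Module.End.isUnit_iff]
    have hu : IsUnit (algebraMap R A s ^ p ^ e) := (IsLocalization.map_units A s).pow _
    have hb := (toFrob p e A).bijective.comp
      (((IsUnit.isUnit_iff_mulLeft_bijective).1 hu).comp (toFrob p e A).symm.bijective)
    convert hb using 1
    funext x
    obtain ⟨x, rfl⟩ := (toFrob p e A).surjective x
    rw [Module.algebraMap_end_apply, smul_toFrob]
    simp [Algebra.smul_def]
  surj y := by
    obtain ⟨y, rfl⟩ := (toFrob p e A).surjective y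
    obtain ⟨⟨x, s⟩, hx⟩ := IsLocalization.surj S y
    refine ⟨(toFrob p e R ((s : R) ^ (p ^ e - 1) * x), s), ?_⟩
    rw [frobPushAlgebraMap_toFrob]
    change (s : R) • toFrob p e A y = _
    rw [smul_toFrob]
    have hq : p ^ e = p ^ e - 1 + 1 :=
      (Nat.sub_add_cancel (Nat.one_le_pow _ _ (Fact.out : p.Prime).pos)).symm
    rw [map_mul, ← hx, hq, Algebra.smul_def, Nat.add_sub_cancel, map_pow, map_pow, pow_succ]
    congr 1
    ring
  exists_of_eq {x y} hxy := by
    obtain ⟨x, rfl⟩ := (toFrob p e R).surjective x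
    obtain ⟨y, rfl⟩ := (toFrob p e R).surjective y
    obtain ⟨c, hc⟩ := (IsLocalization.eq_iff_exists S A).1 ((toFrob p e A).injective hxy)
    simp only [AddEquiv.symm_apply_apply] at hc
    refine ⟨c, ?_⟩
    change (c : R) • toFrob p e R x = (c : R) • toFrob p e R y
    have hq : p ^ e = p ^ e - 1 + 1 :=
      (Nat.sub_add_cancel (Nat.one_le_pow _ _ (Fact.out : p.Prime).pos)).symm
    rw [smul_toFrob, smul_toFrob, hq, pow_succ, smul_eq_mul, smul_eq_mul, mul_assoc, hc,
      ← mul_assoc]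

section Completion

variable (p e : ℕ) {A : Type*} [CommRing A] [ExpChar A p] (I : Ideal A)

theorem toFrob_mem_smul_top_iff (n : ℕ) (x : A) :
    toFrob p e A x ∈ (I ^ n • ⊤ : Submodule A (FrobPush p e A)) ↔
      x ∈ (I ^ n).map (iterateFrobenius A p e) := by
  let _ : Algebra A A := (iterateFrobenius A p e).toAlgebra
  exact SetLike.ext_iff.1 (Ideal.smul_top_eq_map (R := A) (S := A) (I ^ n)) x

theorem map_iterateFrobenius_le [Fact p.Prime] (J : Ideal A) :
    J.map (iterateFrobenius A p e) ≤ J := by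
  refine Ideal.map_le_iff_le_comap.2 fun x hx => ?_
  rw [Ideal.mem_comap, iterateFrobenius_def]
  exact Ideal.pow_mem_of_mem _ hx _ (pow_pos (Fact.out : p.Prime).pos e)

/-- The Frobenius powers of the ideals `I ^ n` define the same topology as the powers of `I`. -/
theorem exists_monotone_pow_le_map_iterateFrobenius [IsNoetherianRing A] :
    ∃ h : ℕ → ℕ, Monotone h ∧
      ∀ n, n ≤ h n ∧ I ^ h n ≤ (I ^ n).map (iterateFrobenius A p e) := by
  have key : ∀ n, ∃ k, I ^ k ≤ (I ^ n).map (iterateFrobenius A p e) := fun n => by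
    refine Ideal.exists_pow_le_of_le_radical_of_fg (fun x hx => ⟨n * p ^ e, ?_⟩)
      (IsNoetherian.noetherian I)
    rw [pow_mul]
    exact Ideal.mem_map_of_mem (iterateFrobenius A p e) (Ideal.pow_mem_pow hx n)
  choose k hk using key
  refine ⟨fun n => ∑ i ∈ Finset.range (n + 1), (k i + 1), ?_, fun n => ⟨?_, ?_⟩⟩
  · intro m n hmn
    exact Finset.sum_le_sum_of_subset (Finset.range_mono (by omega))
  · change n ≤ ∑ i ∈ Finset.range (n + 1), (k i + 1)
    rw [Finset.sum_add_distrib, Finset.sum_const, Finset.card_range]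
    simp only [smul_eq_mul, mul_one]
    omega
  · refine (Ideal.pow_le_pow_right ?_).trans (hk n)
    exact (Nat.le_succ _).trans (Finset.single_le_sum (f := fun i => k i + 1)
      (fun _ _ => Nat.zero_le _) (Finset.self_mem_range_succ n))

variable [ExpChar (AdicCompletion I A) p]

/-- The two maps out of `Â ⊗ F^e_* A`, to the completion of the module `F^e_* A` and to `F^e_* Â`,
agree modulo every power of `I`. -/
theorem exists_val_ofTensorProduct_eq_mk (t : AdicCompletion I A ⊗[A] FrobPush p e A) (n : ℕ) :
    ∃ x : A, (AdicCompletion.ofTensorProduct I (FrobPush p e A) t).val n =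
        Submodule.Quotient.mk (toFrob p e A x) ∧
      AdicCompletion.evalₐ I n ((toFrob p e _).symm
        ((frobPushAlgebraMap p e A (AdicCompletion I A)).liftBaseChange (AdicCompletion I A) t)) =
          Ideal.Quotient.mk _ x := by
  induction t with
  | zero => exact ⟨0, by simp only [map_zero]; exact ⟨rfl, trivial⟩⟩
  | add t t' ht ht' =>
    obtain ⟨x, hx, hx'⟩ := ht
    obtain ⟨y, hy, hy'⟩ := ht'
    refine ⟨x + y, ?_, ?_⟩
    · rw [map_add, AdicCompletion.val_add_apply, hx, hy, map_add, Submodule.Quotient.mk_add]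
    · rw [map_add, map_add, map_add, hx', hy', map_add]
  | tmul c y =>
    obtain ⟨y, rfl⟩ := (toFrob p e A).surjective y
    induction c using AdicCompletion.induction_on with
    | _ c =>
      refine ⟨c n ^ p ^ e * y, ?_, ?_⟩
      · rw [AdicCompletion.ofTensorProduct_tmul]
        rfl
      · rw [LinearMap.liftBaseChange_tmul, frobPushAlgebraMap_toFrob, smul_toFrob,
          AddEquiv.symm_apply_apply, smul_eq_mul, map_mul, map_pow, AdicCompletion.evalₐ_mk,
          AlgHom.commutes, map_mul, map_pow]
        rfl

/-- Completion commutes with the Frobenius pushforward of an `F`-finite noetherian ring. -/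
theorem isBaseChange_frobPushAlgebraMap_adicCompletion [Fact p.Prime]
    [IsNoetherianRing A] [Module.Finite A (FrobPush p e A)] :
    IsBaseChange (AdicCompletion I A) (frobPushAlgebraMap p e A (AdicCompletion I A)) := by
  obtain ⟨h, hmono, hh⟩ := exists_monotone_pow_le_map_iterateFrobenius p e I
  have hof := AdicCompletion.ofTensorProduct_bijective_of_finite_of_isNoetherian I (FrobPush p e A)
  let L := (frobPushAlgebraMap p e A (AdicCompletion I A)).liftBaseChange (AdicCompletion I A)
  have hL : Function.Bijective L := by
    constructor
    · rw [injective_iff_map_eq_zero]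
      intro t ht
      apply hof.1
      rw [map_zero]
      refine AdicCompletion.ext fun n => ?_
      obtain ⟨x, hx, hx'⟩ := exists_val_ofTensorProduct_eq_mk p e I t (h n)
      change AdicCompletion.evalₐ I (h n) ((toFrob p e _).symm (L t)) = _ at hx'
      rw [ht, map_zero, map_zero, eq_comm, Ideal.Quotient.eq_zero_iff_mem] at hx'
      refine ((AdicCompletion.ofTensorProduct I _ t).2 (hh n).1).symm.trans ?_
      rw [hx]
      exact (Submodule.Quotient.mk_eq_zero _).2
        ((toFrob_mem_smul_top_iff p e I n x).2 ((hh n).2 hx'))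
    · intro y
      obtain ⟨y, rfl⟩ := (toFrob p e _).surjective y
      induction y using AdicCompletion.induction_on with
      | _ c =>
        let z : AdicCompletion.AdicCauchySequence I (FrobPush p e A) :=
          ⟨fun n => toFrob p e A (c (h n)), fun {m n} hmn => by
            rw [SModEq.sub_mem, ← map_sub, toFrob_mem_smul_top_iff]
            apply (hh m).2
            simpa [SModEq.sub_mem] using c.2 (hmono hmn)⟩
        obtain ⟨t, ht⟩ := hof.2 (AdicCompletion.mk _ _ z)
        refine ⟨t, (toFrob p e _).symm.injective ?_⟩
        rw [AddEquiv.symm_apply_apply]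
        refine AdicCompletion.ext_evalₐ fun n => ?_
        obtain ⟨x, hx, hx'⟩ := exists_val_ofTensorProduct_eq_mk p e I t n
        refine hx'.trans ?_
        rw [AdicCompletion.evalₐ_mk, Ideal.Quotient.eq]
        rw [ht] at hx
        have h1 : c (h n) - x ∈ I ^ n := by
          have := (Submodule.Quotient.eq _).1 hx
          exact map_iterateFrobenius_le p e _ ((toFrob_mem_smul_top_iff p e I n _).1 this)
        have h2 : c n - c (h n) ∈ I ^ n := by
          simpa [SModEq.sub_mem] using c.2 (hh n).1
        have : x - c n = - ((c n - c (h n)) + (c (h n) - x)) := by ring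
        exact this ▸ neg_mem (add_mem h2 h1)
  refine IsBaseChange.of_equiv (LinearEquiv.ofBijective L hL) fun x => ?_
  rw [LinearEquiv.ofBijective_apply, LinearMap.liftBaseChange_tmul, one_smul]

end Completion

/-- The Frobenius pushforward of an `F`-finite noetherian ring commutes with the passage to the
complete local ring at a prime. -/
theorem isBaseChange_frobPushAlgebraMap_localCompletion (p e : ℕ) [Fact p.Prime] {R : Type u}
    [CommRing R] [CharP R p] [IsNoetherianRing R] [Module.Finite R (FrobPush p e R)]
    (P : Ideal R) [P.IsPrime] :
    IsBaseChange (LocalCompletion P) (frobPushAlgebraMap p e R (LocalCompletion P)) := by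
  let A := Localization.AtPrime P
  have : CharP A p := (CharP.charP_iff_prime_eq_zero Fact.out).2 <| by
    rw [← map_natCast (algebraMap R A), CharP.cast_eq_zero, map_zero]
  have h1 : IsBaseChange A (frobPushAlgebraMap p e R A) :=
    (isLocalizedModule_iff_isBaseChange P.primeCompl A _).1
      (isLocalizedModule_frobPushAlgebraMap p e P.primeCompl A)
  have : Module.Finite A (FrobPush p e A) := Module.Finite.equiv h1.equiv
  have h2 : IsBaseChange (LocalCompletion P) (frobPushAlgebraMap p e A (LocalCompletion P)) :=
    isBaseChange_frobPushAlgebraMap_adicCompletion p e _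
  have : frobPushAlgebraMap p e R (LocalCompletion P) =
      ((frobPushAlgebraMap p e A (LocalCompletion P)).restrictScalars R).comp
        (frobPushAlgebraMap p e R A) :=
    LinearMap.ext fun x => congrArg (toFrob p e (LocalCompletion P))
      (IsScalarTower.algebraMap_apply R A (LocalCompletion P) ((toFrob p e R).symm x))
  rw [this]
  exact h1.comp h2

end FrobeniusBaseChange

/-! ### The identity of `F^(1)_* R` factors through powers of `F^(0)_* R` -/

section Trace

variable {p : ℕ} [Fact p.Prime] {R : Type u} [CommRing R] [CharP R p]

/-- If over every complete local ring of `R` the indecomposable summands of the pushforward of level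
`e` occur in that of level `e'`, then `F^e_* R` is a direct summand of a finite power of
`F^e'_* R`: the trace of `F^e'_* R` in `End (F^e_* R)` lies in no proper ideal. -/
theorem id_mem_factorThrough_frobPush (hR : IsFFinite p R) {e e' : ℕ}
    (h : ∀ (P : Ideal R) [P.IsPrime],
      indecomposables (LocalCompletion P) (FrobPush p e (LocalCompletion P)) ⊆
        indecomposables (LocalCompletion P) (FrobPush p e' (LocalCompletion P))) :
    LinearMap.id ∈ factorThrough R (FrobPush p e R) (FrobPush p e' R) := by
  have := hR.noetherian
  have hfin (n : ℕ) : Module.Finite R (FrobPush p n R) := finite_frobPush p n hR.finite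
  have hfp (n : ℕ) : Module.FinitePresentation R (FrobPush p n R) :=
    Module.finitePresentation_of_finite R _
  let J : Ideal R := (factorThrough R (FrobPush p e R) (FrobPush p e' R)).comap
    (LinearMap.toSpanSingleton R _ LinearMap.id)
  have hJ : J = ⊤ := by
    by_contra hJ
    obtain ⟨P, hP, hJP⟩ := Ideal.exists_le_maximal J hJ
    have hprime := hP.isPrime
    have hnoeth : IsNoetherianRing (Localization.AtPrime P) :=
      IsLocalization.isNoetherianRing P.primeCompl _ inferInstance
    have : Module.Flat R (LocalCompletion P) := Module.Flat.trans R (Localization.AtPrime P) _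
    have h1 := isBaseChange_frobPushAlgebraMap_localCompletion p e P
    have h2 := isBaseChange_frobPushAlgebraMap_localCompletion p e' P
    have : Module.Finite (LocalCompletion P) (FrobPush p e (LocalCompletion P)) :=
      Module.Finite.equiv h1.equiv
    let k := Localization.AtPrime P ⧸ IsLocalRing.maximalIdeal (Localization.AtPrime P)
    have : Nontrivial k :=
      Ideal.Quotient.nontrivial_iff.2 (IsLocalRing.maximalIdeal.isMaximal _).ne_top
    let f : LocalCompletion P →ₐ[R] k := (AdicCompletion.evalOneₐ
      (IsLocalRing.maximalIdeal (Localization.AtPrime P))).restrictScalars R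
    obtain ⟨r, hr, hrk⟩ := exists_smul_id_mem_factorThrough f h1 h2
      (id_mem_factorThrough_of_indecomposables_subset _ _ (h P))
    refine hrk ?_
    have hrP : r ∈ P := hJP hr
    rw [IsScalarTower.algebraMap_apply R (Localization.AtPrime P) k]
    exact Ideal.Quotient.eq_zero_iff_mem.2
      ((IsLocalization.AtPrime.to_map_mem_maximal_iff _ P r).2 hrP)
  have h1 : (1 : R) ∈ J := hJ ▸ Submodule.mem_top
  simpa [J] using h1

theorem exists_sum_frobHom_mul_eq_one (hR : IsFFinite p R) {e e' : ℕ}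
    (h : ∀ (P : Ideal R) [P.IsPrime],
      indecomposables (LocalCompletion P) (FrobPush p e (LocalCompletion P)) ⊆
        indecomposables (LocalCompletion P) (FrobPush p e' (LocalCompletion P))) :
    ∃ (n : ℕ) (φ : Fin n → frobHom p R e' e) (ψ : Fin n → frobHom p R e e'),
      ∑ k, (φ k).1 * (ψ k).1 = 1 := by
  obtain ⟨n, β, α, hs⟩ := exists_sum_comp_eq_id (id_mem_factorThrough_frobPush hR h)
  refine ⟨n, fun k => frobHomEquiv p R e' e (β k), fun k => frobHomEquiv p R e e' (α k), ?_⟩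
  refine AddMonoidHom.ext fun x => ?_
  have := LinearMap.congr_fun hs (toFrob p e R x)
  rw [LinearMap.sum_apply] at this

  exact (AddMonoidHom.finsetSum_apply _ _ _).trans this

/-- Since `R` is noetherian and `F`-finite, `Hom_R(F^i_* R, F^j_* R)` is finitely generated under
multiplication by elements of `R` from the left. -/
theorem exists_finset_frobHom_generators (hR : IsFFinite p R) (i j : ℕ) :
    ∃ s : Finset (frobHom p R i j), ∀ φ : frobHom p R i j, ∃ c : frobHom p R i j → R,
      φ.1 = ∑ χ ∈ s, AddMonoid.End.mulLeft (c χ) * χ.1 := by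
  classical
  have := hR.noetherian
  have hfin (n : ℕ) : Module.Finite R (FrobPush p n R) := finite_frobPush p n hR.finite
  obtain ⟨s, hs⟩ := (inferInstance :
    Module.Finite R (FrobPush p i R →ₗ[R] FrobPush p j R)).fg_top
  refine ⟨s.image (frobHomEquiv p R i j), fun φ => ?_⟩
  obtain ⟨f, rfl⟩ := (frobHomEquiv p R i j).surjective φ
  obtain ⟨c, hc⟩ := Submodule.mem_span_finset.1 (hs ▸ Submodule.mem_top : f ∈ Submodule.span R _)
  refine ⟨fun χ => c ((frobHomEquiv p R i j).symm χ) ^ p ^ j, ?_⟩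
  rw [Finset.sum_image fun _ _ _ _ h => (frobHomEquiv p R i j).injective h, ← hc.2, map_sum,
    AddSubgroup.val_finsetSum]
  refine Finset.sum_congr rfl fun g _ => ?_
  rfl

end Trace

/-! ### Unit modules -/

section UnitModule

variable {p : ℕ} {R : Type u} [CommRing R] {a b : ℕ}

section Operators

variable (p R a b) in
/-- The inclusion of the homogeneous piece of degree `i` in `𝒟^(0)⟨Φ⟩`. -/
abbrev homOf (i : ℕ) : homPiece p R a b i →+ DPhi p R a b :=
  DirectSum.of (fun i => homPiece p R a b i) i

variable (p R a b) in
/-- Multiplication by `r`, as an element of the degree zero piece of `𝒟^(0)⟨Φ⟩`. -/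
def mulPiece (r : R) : homPiece p R a b 0 :=
  ⟨AddMonoid.End.mulLeft r, fun x y => by
    change r * _ = x ^ p ^ (a + 0 * b) * (r * y)
    rw [zero_mul, add_zero, mul_left_comm]⟩

theorem baseToDPhi_apply (r : R) :
    baseToDPhi p R a b r = homOf p R a b 0 (mulPiece p R a b r) := rfl

theorem of_eq_of {i j : ℕ} (h : i = j) {φ : homPiece p R a b i} {ψ : homPiece p R a b j}
    (hφ : φ.1 = ψ.1) : homOf p R a b i φ =
      homOf p R a b j ψ := by
  subst h
  rw [Subtype.ext hφ]

theorem of_mul_of_eq {i j k : ℕ} (h : i + j = k) {φ : homPiece p R a b i} {ψ : homPiece p R a b j}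
    {χ : homPiece p R a b k} (hχ : φ.1 * ψ.1 = χ.1) :
    homOf p R a b i φ * homOf p R a b j ψ =
      homOf p R a b k χ :=
  (DirectSum.of_mul_of (A := fun i => homPiece p R a b i) _ _).trans (of_eq_of h hχ)

theorem mul_mem_homPiece {ψ : AddMonoid.End R} (hψ : ψ ∈ frobHom p R (a + 1 * b) a) {j k : ℕ}
    (hjk : 1 + j = k) {φ : AddMonoid.End R} (hφ : φ ∈ homPiece p R a b k) :
    ψ * φ ∈ homPiece p R a b j := by
  subst hjk
  intro x y
  change ψ (φ _) = _ * ψ (φ y)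
  have h : x ^ p ^ (a + (1 + j) * b) = (x ^ p ^ (j * b)) ^ p ^ (a + 1 * b) := by
    rw [← pow_mul, ← pow_add]; congr 2; ring
  rw [hφ, h, hψ, ← pow_mul, ← pow_add, add_comm (j * b)]

theorem mulLeft_mul_mem_homPiece (r : R) {i : ℕ} {φ : AddMonoid.End R}
    (hφ : φ ∈ homPiece p R a b i) : AddMonoid.End.mulLeft r * φ ∈ homPiece p R a b i :=
  fun x y => by
    change r * φ _ = _ * (r * φ y)
    rw [hφ, mul_left_comm]

theorem baseToDPhi_mul_homOf (r : R) {i : ℕ} (φ : homPiece p R a b i) :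
    baseToDPhi p R a b r * homOf p R a b i φ =
      homOf p R a b i ⟨_, mulLeft_mul_mem_homPiece r φ.2⟩ := by
  rw [baseToDPhi_apply]
  exact of_mul_of_eq (zero_add i) rfl

/-- The commutation rule `r ^ (p ^ (a + i b)) φ = φ r ^ (p ^ a)` in `𝒟^(0)⟨Φ⟩`. -/
theorem baseToDPhi_pow_mul_homOf (r : R) {i : ℕ} (φ : homPiece p R a b i) :
    baseToDPhi p R a b (r ^ p ^ (a + i * b)) * homOf p R a b i φ =
      homOf p R a b i φ * baseToDPhi p R a b (r ^ p ^ a) := by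
  rw [baseToDPhi_mul_homOf, baseToDPhi_apply]
  exact (of_mul_of_eq (add_zero i) (AddMonoidHom.ext fun z => φ.2 r z)).symm

end Operators

variable {M : Type v} [AddCommGroup M] [Module (DPhi p R a b) M]

/-- On a unit module `M ≅ Hom(F^(0)_* R, F^(1)_* R) ⊗ M`, every `R`-linear map
`ψ : F^(1)_* R → F^(0)_* R` acts by `φ ⊗ m ↦ (ψ φ) m`. -/
theorem exists_backward_action (hunit : IsUnitModule p R a b M)
    (ψ : frobHom p R (a + 1 * b) a) :
    ∃ g : M →+ M, ∀ (φ : homPiece p R a b 1) (m : M),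
      g (homOf p R a b 1 φ • m) =
        homOf p R a b 0
          ⟨ψ.1 * φ.1, mul_mem_homPiece ψ.2 (add_zero 1) φ.2⟩ • m := by
  let _ := moduleDiffOp p R a b M
  -- The map `φ ↦ ψ φ` from `Hom(F^(0)_* R, F^(1)_* R)` to `𝒟^(0)` commutes with the right action
  -- of `𝒟^(0)`, so it induces a map on the tensor product with `M`.
  let c : homPiece p R a b 1 →+ DPhi p R a b :=
    (homOf p R a b 0).comp
      { toFun := fun φ => ⟨ψ.1 * φ.1, mul_mem_homPiece ψ.2 (add_zero 1) φ.2⟩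
        map_zero' := Subtype.ext (mul_zero ψ.1)
        map_add' := fun φ φ' => Subtype.ext (mul_add ψ.1 φ.1 φ'.1) }
  let T : (homOne p R a b) ⊗[ℤ] M →ₗ[ℤ] M :=
    TensorProduct.lift (LinearMap.mk₂ ℤ (fun φ m => c φ • m)
      (fun φ φ' m => by rw [map_add, add_smul])
      (fun n φ m => by
        rw [map_zsmul]
        exact map_zsmul ((smulAddHom (DPhi p R a b) M).flip m) n _)
      (fun φ m m' => smul_add _ m m')
      (fun n φ m => smul_comm _ n m))
  let T' : PhiPullback p R a b M →ₗ[ℤ] M := Submodule.liftQ _ T <| by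
    rw [Submodule.span_le]
    rintro _ ⟨φ, d, m, rfl⟩
    rw [SetLike.mem_coe, LinearMap.mem_ker, map_sub, sub_eq_zero]
    change c (MulOpposite.op d • φ) • m = c φ • (diffOpToDPhi p R a b d • m)
    rw [← mul_smul]
    congr 1
    exact (of_mul_of_eq (zero_add 0) (mul_assoc _ _ _)).symm
  let e := LinearEquiv.ofBijective (structureMap p R a b M) hunit
  refine ⟨(T' ∘ₗ e.symm.toLinearMap).toAddMonoidHom, fun φ m => ?_⟩
  have : e.symm (homOf p R a b 1 φ • m) =
      Submodule.Quotient.mk (φ ⊗ₜ[ℤ] m) := by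
    rw [LinearEquiv.symm_apply_eq]
    rfl
  change T' (e.symm _) = _
  rw [this]
  rfl

/-- The additive group `Hom(F^(0)_* R, F^(1)_* R) · N` generated by the elements `φ n` with
`n ∈ N`. -/
def frobSpan (p : ℕ) (R : Type u) [CommRing R] (a b : ℕ) {M : Type v} [AddCommGroup M]
    [Module (DPhi p R a b) M] (N : AddSubgroup M) : AddSubgroup M :=
  AddSubgroup.closure {x | ∃ φ : homPiece p R a b 1, ∃ m ∈ N, x = homOf p R a b 1 φ • m}

theorem smul_mem_frobSpan {N : AddSubgroup M} (φ : homPiece p R a b 1) {m : M} (hm : m ∈ N) :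
    homOf p R a b 1 φ • m ∈ frobSpan p R a b N :=
  AddSubgroup.subset_closure ⟨φ, m, hm, rfl⟩

theorem frobSpan_mono {N N' : AddSubgroup M} (h : N ≤ N') :
    frobSpan p R a b N ≤ frobSpan p R a b N' :=
  AddSubgroup.closure_mono fun _ ⟨φ, m, hm, hx⟩ => ⟨φ, m, h hm, hx⟩

theorem homOf_zero_smul_mem_frobSpan (N : AddSubgroup M) (d : homPiece p R a b 0) {m : M}
    (hm : m ∈ frobSpan p R a b N) : homOf p R a b 0 d • m ∈ frobSpan p R a b N := by
  induction hm using AddSubgroup.closure_induction with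
  | mem x hx =>
    obtain ⟨φ, m, hm, rfl⟩ := hx
    have hmem : d.1 * φ.1 ∈ homPiece p R a b 1 := by
      simpa using SetLike.mul_mem_graded (A := homPiece p R a b) d.2 φ.2
    rw [← mul_smul, of_mul_of_eq (zero_add 1) (χ := ⟨d.1 * φ.1, hmem⟩) rfl]
    exact smul_mem_frobSpan _ hm
  | zero => rw [smul_zero]; exact zero_mem _
  | add x y _ _ hx hy => rw [smul_add]; exact add_mem hx hy
  | neg x _ hx => rw [smul_neg]; exact neg_mem hx

theorem frobSpan_top (hunit : IsUnitModule p R a b M) :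
    frobSpan p R a b (⊤ : AddSubgroup M) = ⊤ := by
  refine eq_top_iff.2 fun m _ => ?_
  obtain ⟨t, rfl⟩ := hunit.2 m
  obtain ⟨t, rfl⟩ := Submodule.Quotient.mk_surjective _ t
  suffices h : ∀ t, preStructureMap p R a b M t ∈ frobSpan p R a b (⊤ : AddSubgroup M) from h t
  intro t
  induction t with
  | zero => rw [map_zero]; exact zero_mem _
  | tmul φ m => exact smul_mem_frobSpan φ (AddSubgroup.mem_top m)
  | add t t' ht ht' => rw [map_add]; exact add_mem ht ht'

theorem addMonoidHom_ext_of_isUnitModule (hunit : IsUnitModule p R a b M) {f g : M →+ M}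
    (h : ∀ (φ : homPiece p R a b 1) (m : M),
      f (homOf p R a b 1 φ • m) = g (homOf p R a b 1 φ • m)) : f = g := by
  refine AddMonoidHom.eq_of_eqOn_dense (frobSpan_top hunit) ?_
  rintro _ ⟨φ, m, -, rfl⟩
  exact h φ m

section Filtration

/-- The filtration of the module generated by `G`: the additive group generated by the elements
`φ g` with `g ∈ G` and `φ ∈ Hom(F^(0)_* R, F^(i)_* R)` for some `i ≤ t`. -/
def degreeFiltration (p : ℕ) (R : Type u) [CommRing R] (a b : ℕ) {M : Type v} [AddCommGroup M]
    [Module (DPhi p R a b) M] (G : Set M) (t : ℕ) : AddSubgroup M :=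
  AddSubgroup.closure {x | ∃ i ≤ t, ∃ φ : homPiece p R a b i, ∃ m ∈ G, x = homOf p R a b i φ • m}

variable {G : Set M}

theorem homOf_smul_mem_degreeFiltration {i t : ℕ} (hi : i ≤ t) (φ : homPiece p R a b i) {m : M}
    (hm : m ∈ G) : homOf p R a b i φ • m ∈ degreeFiltration p R a b G t :=
  AddSubgroup.subset_closure ⟨i, hi, φ, m, hm, rfl⟩

theorem degreeFiltration_mono : Monotone (degreeFiltration p R a b G) := fun _ _ h =>
  AddSubgroup.closure_mono fun _ ⟨i, hi, φ, m, hm, hx⟩ => ⟨i, hi.trans h, φ, m, hm, hx⟩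

theorem homOf_zero_smul_mem_degreeFiltration {t : ℕ} (d : homPiece p R a b 0) {m : M}
    (hm : m ∈ degreeFiltration p R a b G t) :
    homOf p R a b 0 d • m ∈ degreeFiltration p R a b G t := by
  induction hm using AddSubgroup.closure_induction with
  | mem x hx =>
    obtain ⟨i, hi, φ, m, hm, rfl⟩ := hx
    have hmem : d.1 * φ.1 ∈ homPiece p R a b i := by
      simpa using SetLike.mul_mem_graded (A := homPiece p R a b) d.2 φ.2
    rw [← mul_smul, of_mul_of_eq (zero_add i) (χ := ⟨d.1 * φ.1, hmem⟩) rfl]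
    exact homOf_smul_mem_degreeFiltration hi _ hm
  | zero => rw [smul_zero]; exact zero_mem _
  | add x y _ _ hx hy => rw [smul_add]; exact add_mem hx hy
  | neg x _ hx => rw [smul_neg]; exact neg_mem hx

theorem exists_mem_degreeFiltration (hG : Submodule.span (DPhi p R a b) G = ⊤) (m : M) :
    ∃ t, m ∈ degreeFiltration p R a b G t := by
  have hsmul (d : DPhi p R a b) (m : M) (hm : m ∈ G) :
      ∃ t, d • m ∈ degreeFiltration p R a b G t := by
    induction d using DirectSum.induction_on with
    | zero => exact ⟨0, (congrArg (· ∈ _) (zero_smul (DPhi p R a b) m)).mpr (zero_mem _)⟩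
    | of i φ => exact ⟨i, homOf_smul_mem_degreeFiltration le_rfl φ hm⟩
    | add d d' hd hd' =>
      obtain ⟨t, ht⟩ := hd
      obtain ⟨t', ht'⟩ := hd'
      refine ⟨max t t', ?_⟩
      rw [add_smul]
      exact add_mem (degreeFiltration_mono (le_max_left _ _) ht)
        (degreeFiltration_mono (le_max_right _ _) ht')
  obtain ⟨n, d, g, rfl⟩ := Submodule.mem_span_set'.1 (hG ▸ Submodule.mem_top :
    m ∈ Submodule.span (DPhi p R a b) G)
  choose t ht using fun i => hsmul (d i) _ (g i).2
  exact ⟨Finset.univ.sup t, sum_mem fun i _ =>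
    degreeFiltration_mono (Finset.le_sup (Finset.mem_univ i)) (ht i)⟩

theorem exists_mem_frobSpan_degreeFiltration (hunit : IsUnitModule p R a b M)
    (hG : Submodule.span (DPhi p R a b) G = ⊤) (m : M) :
    ∃ t, m ∈ frobSpan p R a b (degreeFiltration p R a b G t) := by
  have hm : m ∈ frobSpan p R a b (⊤ : AddSubgroup M) :=
    (frobSpan_top hunit).ge (AddSubgroup.mem_top m)
  induction hm using AddSubgroup.closure_induction with
  | mem x hx =>
    obtain ⟨φ, m, -, rfl⟩ := hx
    obtain ⟨t, ht⟩ := exists_mem_degreeFiltration hG m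
    exact ⟨t, smul_mem_frobSpan φ ht⟩
  | zero => exact ⟨0, zero_mem _⟩
  | add x y _ _ hx hy =>
    obtain ⟨t, ht⟩ := hx
    obtain ⟨t', ht'⟩ := hy
    exact ⟨max t t', add_mem (frobSpan_mono (degreeFiltration_mono (le_max_left _ _)) ht)
      (frobSpan_mono (degreeFiltration_mono (le_max_right _ _)) ht')⟩
  | neg x _ hx => exact hx.imp fun t ht => neg_mem ht

variable {n : ℕ} {φ : Fin n → frobHom p R a (a + 1 * b)} {ψ : Fin n → frobHom p R (a + 1 * b) a}

/-- If the identity of `F^(1)_* R` factors through powers of `F^(0)_* R`, then `𝒟^(0)⟨Φ⟩` is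
generated in degrees `0` and `1`: `χ = ∑ φ_k (ψ_k χ)` writes an element of positive degree `i` in
terms of elements of degree `1` and `i - 1`. -/
theorem homOf_eq_sum (h : ∑ k, (φ k).1 * (ψ k).1 = 1) {i j : ℕ} (hij : 1 + j = i)
    (χ : homPiece p R a b i) :
    homOf p R a b i χ = ∑ k, homOf p R a b 1 (φ k) *
      homOf p R a b j ⟨(ψ k).1 * χ.1, mul_mem_homPiece (ψ k).2 hij χ.2⟩ := by
  have hmem (k : Fin n) : (φ k).1 * ((ψ k).1 * χ.1) ∈ homPiece p R a b i := by
    subst hij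
    exact SetLike.mul_mem_graded (A := homPiece p R a b) (φ k).2
      (mul_mem_homPiece (ψ k).2 rfl χ.2)
  have hsum : χ = ∑ k, (⟨_, hmem k⟩ : homPiece p R a b i) := by
    refine Subtype.ext ?_
    rw [AddSubgroup.val_finsetSum]
    change χ.1 = ∑ k, (φ k).1 * ((ψ k).1 * χ.1)
    simp only [← mul_assoc]
    rw [← Finset.sum_mul, h, one_mul]
  have hterm (k : Fin n) := of_mul_of_eq (φ := φ k)
    (ψ := ⟨(ψ k).1 * χ.1, mul_mem_homPiece (ψ k).2 hij χ.2⟩) (χ := ⟨_, hmem k⟩) hij rfl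
  rw [Finset.sum_congr rfl fun k _ => hterm k, ← map_sum, ← hsum]

theorem degreeFiltration_succ_le_frobSpan (h : ∑ k, (φ k).1 * (ψ k).1 = 1) {t : ℕ}
    (hG : G ⊆ frobSpan p R a b (degreeFiltration p R a b G t)) :
    degreeFiltration p R a b G (t + 1) ≤ frobSpan p R a b (degreeFiltration p R a b G t) := by
  refine (AddSubgroup.closure_le _).2 ?_
  rintro _ ⟨i, hi, χ, m, hm, rfl⟩
  match i, χ with
  | 0, χ => exact homOf_zero_smul_mem_frobSpan _ χ (hG hm)
  | j + 1, χ =>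
    rw [homOf_eq_sum h (add_comm 1 j), Finset.sum_smul]
    refine sum_mem fun k _ => ?_
    rw [mul_smul]
    exact smul_mem_frobSpan (φ k) (homOf_smul_mem_degreeFiltration (by omega) _ hm)

end Filtration

section AssociatedPrimes

variable [Module R M]

/-- The prime ideal `P` is the radical of the annihilator of an element of `N`. This is the notion
of an associated prime of `N`, phrased inside `M` so that `N` may be a mere additive subgroup. -/
def IsRadicalAnnihilatorIn (N : AddSubgroup M) (P : Ideal R) : Prop :=
  P.IsPrime ∧ ∃ y ∈ N, P = (Submodule.colon (⊥ : Submodule R M) {y}).radical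

theorem mem_radical_colon_bot_iff {y : M} {r : R} :
    r ∈ (Submodule.colon (⊥ : Submodule R M) {y}).radical ↔ ∃ n : ℕ, r ^ n • y = 0 := by
  simp [Ideal.mem_radical_iff, Submodule.mem_colon_singleton]

theorem pow_smul_eq_zero {r : R} {y : M} (h : r • y = 0) {n : ℕ} (hn : n ≠ 0) : r ^ n • y = 0 := by
  obtain ⟨n, rfl⟩ := Nat.exists_eq_succ_of_ne_zero hn
  rw [pow_succ, mul_smul, h, smul_zero]

/-- Passing from `N` to `Hom(F^(0)_* R, F^(1)_* R) · N` creates no new associated primes. If `P` is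
the radical of the annihilator of `y = ∑ φ_k (ψ_k y)`, then each `ψ_k y` lies in `N` and is killed
by powers of all elements of `P`, and one of them is killed by no element outside `P`. -/
theorem IsRadicalAnnihilatorIn.of_frobSpan [Fact p.Prime]
    (hr : ∀ (r : R) (m : M), r • m = baseToDPhi p R a b r • m)
    (hunit : IsUnitModule p R a b M) {n : ℕ} {φ : Fin n → frobHom p R a (a + 1 * b)}
    {ψ : Fin n → frobHom p R (a + 1 * b) a} (h : ∑ k, (φ k).1 * (ψ k).1 = 1)
    {N : AddSubgroup M}
    (hN : ∀ (d : homPiece p R a b 0), ∀ m ∈ N, homOf p R a b 0 d • m ∈ N) {P : Ideal R}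
    (hP : IsRadicalAnnihilatorIn (frobSpan p R a b N) P) : IsRadicalAnnihilatorIn N P := by
  obtain ⟨hprime, y, hy, hPy⟩ := hP
  have hq (e : ℕ) : p ^ e ≠ 0 := pow_ne_zero e (Fact.out : p.Prime).ne_zero
  choose g hg using fun k => exists_backward_action hunit (ψ k)
  have hgN (k) : g k y ∈ N := by
    suffices hle : frobSpan p R a b N ≤ N.comap (g k) from hle hy
    refine (AddSubgroup.closure_le _).2 ?_
    rintro _ ⟨χ, m, hm, rfl⟩
    change g k _ ∈ N
    rw [hg]
    exact hN _ _ hm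
  -- The map `g k` intertwines the `p ^ (a + b)`-th and the `p ^ a`-th powers of scalars.
  have hlin (k) (r : R) : g k (r ^ p ^ (a + 1 * b) • y) = r ^ p ^ a • g k y := by
    refine DFunLike.congr_fun (addMonoidHom_ext_of_isUnitModule hunit
      (f := (g k).comp (DistribSMul.toAddMonoidHom M (r ^ p ^ (a + 1 * b))))
      (g := (DistribSMul.toAddMonoidHom M (r ^ p ^ a)).comp (g k)) fun χ m => ?_) y
    change g k (r ^ p ^ (a + 1 * b) • _) = r ^ p ^ a • g k _
    rw [hr, hr, ← mul_smul, baseToDPhi_mul_homOf, hg, hg, ← mul_smul, baseToDPhi_mul_homOf]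
    congr 1
    exact of_eq_of rfl (AddMonoidHom.ext fun z => (ψ k).2 r (χ.1 z))
  have hsum : ∑ k, homOf p R a b 1 (φ k) • g k y = y := by
    have := DFunLike.congr_fun (addMonoidHom_ext_of_isUnitModule hunit
      (f := ∑ k, (DistribSMul.toAddMonoidHom M (homOf p R a b 1 (φ k))).comp (g k))
      (g := AddMonoidHom.id M) fun χ m => ?_) y
    · rwa [AddMonoidHom.finsetSum_apply] at this
    · rw [AddMonoidHom.finsetSum_apply]
      change ∑ k, homOf p R a b 1 (φ k) • g k _ = _
      rw [AddMonoidHom.id_apply]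
      conv_rhs => rw [homOf_eq_sum h (add_zero 1) χ, Finset.sum_smul]
      refine Finset.sum_congr rfl fun k _ => ?_
      rw [hg, mul_smul]
  obtain ⟨k, hk⟩ : ∃ k, ∀ s : R, s • g k y = 0 → s ∈ P := by
    by_contra! hcon
    choose s hs hsP using hcon
    have hprod : ∏ k, s k ∉ P := fun hmem => by
      obtain ⟨k, -, hk⟩ := hprime.prod_mem_iff.1 hmem
      exact hsP k hk
    refine hprod ?_
    rw [hPy, mem_radical_colon_bot_iff]
    refine ⟨p ^ (a + 1 * b), ?_⟩
    rw [← hsum, Finset.smul_sum]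
    refine Finset.sum_eq_zero fun k _ => ?_
    obtain ⟨c, hc⟩ := Finset.dvd_prod_of_mem s (Finset.mem_univ k)
    have hzero : (∏ k, s k) • g k y = 0 := by
      rw [hc, mul_comm, mul_smul, hs, smul_zero]
    rw [hr, ← mul_smul, baseToDPhi_pow_mul_homOf, mul_smul, ← hr, pow_smul_eq_zero hzero (hq a),
      smul_zero]
  refine ⟨hprime, g k y, hgN k, le_antisymm (fun r hrP => ?_) ?_⟩
  · rw [hPy, mem_radical_colon_bot_iff] at hrP
    obtain ⟨n, hn⟩ := hrP
    refine mem_radical_colon_bot_iff.2 ⟨n * p ^ a, ?_⟩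
    rw [pow_mul, ← hlin, pow_smul_eq_zero hn (hq _), map_zero]
  · refine hprime.radical_le_iff.2 fun r hr' => hk r ?_
    simpa [Submodule.mem_colon_singleton] using hr'

end AssociatedPrimes

end UnitModule

/-! ### Finiteness of the associated primes -/

section Finiteness

variable {p : ℕ} [Fact p.Prime] {R : Type u} [CommRing R] [CharP R p] {a b : ℕ}
  {M : Type v} [AddCommGroup M] [Module (DPhi p R a b) M] [Module R M]

/-- Every step of the filtration of a finitely generated module lies in a finitely generated
`R`-submodule, because the groups `Hom_R(F^(0)_* R, F^(i)_* R)` are finitely generated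
over `R`. -/
theorem exists_fg_degreeFiltration_le (hR : IsFFinite p R)
    (hr : ∀ (r : R) (m : M), r • m = baseToDPhi p R a b r • m) {G : Set M} (hG : G.Finite)
    (t : ℕ) :
    ∃ N : Submodule R M, N.FG ∧ degreeFiltration p R a b G t ≤ N.toAddSubgroup := by
  choose s hs using fun i => exists_finset_frobHom_generators hR a (a + i * b)
  let gens : Set M := ⋃ i ∈ Set.Iic t, ⋃ χ ∈ s i,
    (fun m : M => homOf p R a b i χ • m) '' G
  have hfin : gens.Finite := (Set.finite_Iic t).biUnion fun i _ =>
    (s i).finite_toSet.biUnion fun χ _ => hG.image _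
  refine ⟨Submodule.span R gens, Submodule.fg_span hfin, (AddSubgroup.closure_le _).2 ?_⟩
  rintro _ ⟨i, hi, φ, m, hm, rfl⟩
  obtain ⟨c, hc⟩ := hs i φ
  have hφ : φ = ∑ χ ∈ s i, (⟨_, mulLeft_mul_mem_homPiece (c χ) χ.2⟩ : homPiece p R a b i) := by
    refine Subtype.ext ?_
    rw [AddSubgroup.val_finsetSum, hc]
  have hsum : homOf p R a b i φ • m = ∑ χ ∈ s i, c χ • homOf p R a b i χ • m := by
    conv_lhs => rw [hφ, map_sum, Finset.sum_smul]
    refine Finset.sum_congr rfl fun χ _ => ?_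
    rw [hr, ← mul_smul, baseToDPhi_mul_homOf]
  change _ ∈ Submodule.span R gens
  rw [hsum]
  refine Submodule.sum_mem _ fun χ hχ => Submodule.smul_mem _ _ (Submodule.subset_span ?_)
  exact Set.mem_biUnion hi (Set.mem_biUnion hχ ⟨m, hm, rfl⟩)

/-- From some `t₀` on, each step of the filtration lies in `Hom(F^(0)_* R, F^(1)_* R)` times the
preceding step, so all associated primes already occur in step `t₀`, which is contained in a
finitely generated `R`-module. -/
theorem finite_associatedPrimes_of_isUnitModule (hR : IsFFinite p R)
    (hr : ∀ (r : R) (m : M), r • m = baseToDPhi p R a b r • m)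
    (hfg : Module.Finite (DPhi p R a b) M) (hunit : IsUnitModule p R a b M) {n : ℕ}
    {φ : Fin n → frobHom p R a (a + 1 * b)} {ψ : Fin n → frobHom p R (a + 1 * b) a}
    (h : ∑ k, (φ k).1 * (ψ k).1 = 1) : (associatedPrimes R M).Finite := by
  have := hR.noetherian
  obtain ⟨G, hG⟩ := hfg.fg_top
  choose τ hτ using fun m : M => exists_mem_frobSpan_degreeFiltration hunit hG m
  let t₀ := G.sup τ
  have hstep (t : ℕ) (ht : t₀ ≤ t) : (G : Set M) ⊆
      frobSpan p R a b (degreeFiltration p R a b (G : Set M) t) := fun m hm =>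
    frobSpan_mono (degreeFiltration_mono ((Finset.le_sup hm).trans ht)) (hτ m)
  have hdown (P : Ideal R) (t : ℕ) (ht : t₀ ≤ t)
      (hP : IsRadicalAnnihilatorIn (degreeFiltration p R a b (G : Set M) t) P) :
      IsRadicalAnnihilatorIn (degreeFiltration p R a b (G : Set M) t₀) P := by
    induction t, ht using Nat.le_induction with
    | base => exact hP
    | succ t ht ih =>
      obtain ⟨hprime, y, hy, hPy⟩ := hP
      exact ih (IsRadicalAnnihilatorIn.of_frobSpan hr hunit h
        (fun d m hm => homOf_zero_smul_mem_degreeFiltration d hm)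
        ⟨hprime, y, degreeFiltration_succ_le_frobSpan h (hstep t ht) hy, hPy⟩)
  obtain ⟨N, hN, hle⟩ := exists_fg_degreeFiltration_le hR hr G.finite_toSet t₀
  have : Module.Finite R N := Module.Finite.iff_fg.2 hN
  refine (associatedPrimes.finite R N).subset fun P hP => ?_
  obtain ⟨hprime, x, hx⟩ := hP
  obtain ⟨t, ht⟩ := exists_mem_degreeFiltration hG x
  obtain ⟨-, y, hy, hPy⟩ := hdown P (max t₀ t) (le_max_left _ _)
    ⟨hprime, x, degreeFiltration_mono (le_max_right _ _) ht, hx⟩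
  refine ⟨hprime, ⟨y, hle hy⟩, ?_⟩
  rw [hPy]
  ext r
  simp only [mem_radical_colon_bot_iff, Subtype.ext_iff, Submodule.coe_smul, Submodule.coe_zero]

end Finiteness

end FFRT

theorem mainTheorem3 (p : ℕ) [Fact p.Prime] (R : Type u) [CommRing R] [CharP R p]
    (hR : FFRT.IsCLFFRT p R) (a b : ℕ) (hab : FFRT.IsFFRTPair p R a b)
    (M : Type v) [AddCommGroup M] [Module (FFRT.DPhi p R a b) M]
    (hfg : Module.Finite (FFRT.DPhi p R a b) M) (hunit : FFRT.IsUnitModule p R a b M) :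
    letI : Module R M := FFRT.moduleBase p R a b M
    (associatedPrimes R M).Finite := by
  let _ : Module R M := FFRT.moduleBase p R a b M
  obtain ⟨n, φ, ψ, h⟩ := FFRT.exists_sum_frobHom_mul_eq_one hR.fFinite (e := a + 1 * b) (e' := a)
    fun P _ => (hab.eq P 1).subset
  exact FFRT.finite_associatedPrimes_of_isUnitModule hR.fFinite (fun _ _ => rfl) hfg hunit h
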